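/- For integers $s_1\ge 2$, $s_2,\dots,s_k\ge 1$ let $$\zeta(s_1,\dots,s_k)=\sum_{m_1>\cdots>m_k>0}\frac{1}{m_1^{s_1}\cdots m_k^{s_k}},$$ a convergent series. For $r\ge 0$ and positive integers $t_1,\dots,t_r$ put $$\mathcal C(t_1,\dots,t_r)=\Big(\sum_{j=1}^{r}2^{t_1+\cdots+t_j-j}\Big)+2^{t_1+\cdots+t_r-r},$$ so that $\mathcal C(\emptyset)=1$. **Weighted sum formula.** Let $k\ge 2$ and $n\ge k+1$ be integers. Then $$\sum_{\substack{s_i\ge 1,\ s_1\ge 2\\ s_1+\cdots+s_k=n}}\Big[2^{s_1-1}+(2^{s_1-1}-1)\Big(\sum_{i=2}^{k-1}2^{S_i-s_1-(i-1)}+2^{S_{k-1}-s_1-(k-2)}\Big)\Big]\zeta(s_1,\dots,s_k)=n\,\zeta(n),$$ where $S_i=s_1+\cdots+s_i$ and $\zeta(n)$ is the value of the Riemann zeta function. For every $(s_1,\dots,s_k)$ in the sum, the weight in brackets equals $\mathcal C(s_1,\dots,s_{k-1})-\mathcal C(s_2,\dots,s_{k-1})$; hence, equivalently, $$\sum_{\substack{t_i\ge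 1,\ t_1\ge 2\\ t_1+\cdots+t_k=n}}\big[\mathcal C(t_1,\dots,t_{k-1})-\mathcal C(t_2,\dots,t_{k-1})\big]\zeta(t_1,\dots,t_k)=n\,\zeta(n).$$ In particular, for $k=2$ and every $n\ge 3$, $$\sum_{i=2}^{n-1}(2^i-1)\,\zeta(i,n-i)=n\,\zeta(n),$$ and, as a consequence, the Ohno–Zudilin weighted Euler sum formula holds for every $n\ge 3$: $$\sum_{i=2}^{n-1}2^i\,\zeta(i,n-i)=(n+1)\,\zeta(n).$$ -/

import Mathlib

noncomputable section

namespace MZV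

/-- The index set `{(m_1, …, m_k) : m_1 > ⋯ > m_k > 0}` (coordinates are numbered from `0`). -/
def Index (k : ℕ) : Type :=
  {m : Fin k → ℕ // StrictAnti m ∧ ∀ i, 0 < m i}

/-- The summand `1 / (m_1^{s_1} ⋯ m_k^{s_k})`. -/
def term {k : ℕ} (s : Fin k → ℕ) (m : Index k) : ℝ :=
  1 / ∏ i, (m.1 i : ℝ) ^ s i

/-- The multiple zeta value `ζ(s_1, …, s_k) = ∑_{m_1 > ⋯ > m_k > 0} 1 / (m_1^{s_1} ⋯ m_k^{s_k})`. -/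
def mzv {k : ℕ} (s : Fin k → ℕ) : ℝ :=
  ∑' m : Index k, term s m

/-- The finite set of `(s_1, …, s_k)` with `s_i ≥ 1`, `s_1 ≥ 2` and `s_1 + ⋯ + s_k = n`. -/
def admissible (k n : ℕ) : Finset (Fin k → ℕ) :=
  (Finset.Nat.antidiagonalTuple k n).filter
    (fun s => (∀ i, 1 ≤ s i) ∧ ∀ i : Fin k, (i : ℕ) = 0 → 2 ≤ s i)

/-- The partial sum `S_i = s_1 + ⋯ + s_i`, as an integer. -/
def partialSum {k : ℕ} (s : Fin k → ℕ) (i : ℕ) : ℤ :=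
  ∑ j ∈ Finset.univ.filter (fun j : Fin k => (j : ℕ) < i), (s j : ℤ)

/-- The coefficient
`C(t_1, …, t_r) = ∑_{j=1}^{r} 2^{t_1 + ⋯ + t_j - j} + 2^{t_1 + ⋯ + t_r - r}`;
for `r = 0` this is `C(∅) = 1`. -/
def coeffC {r : ℕ} (t : Fin r → ℕ) : ℝ :=
  ∑ j ∈ Finset.Icc 1 r, (2 : ℝ) ^ (partialSum t j - (j : ℤ))
    + (2 : ℝ) ^ (partialSum t r - (r : ℤ))

/-- The weight
`2^{s_1-1} + (2^{s_1-1} - 1) (∑_{i=2}^{k-1} 2^{S_i-s_1-(i-1)} + 2^{S_{k-1}-s_1-(k-2)})`. -/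
def weight {k : ℕ} (hk : 2 ≤ k) (s : Fin k → ℕ) : ℝ :=
  let s₁ : ℤ := s ⟨0, by omega⟩
  (2 : ℝ) ^ (s₁ - 1) + ((2 : ℝ) ^ (s₁ - 1) - 1) *
    (∑ i ∈ Finset.Icc 2 (k - 1), (2 : ℝ) ^ (partialSum s i - s₁ - ((i : ℤ) - 1))
      + (2 : ℝ) ^ (partialSum s (k - 1) - s₁ - ((k : ℤ) - 2)))

/-- The weight `C(t_1, …, t_{k-1}) - C(t_2, …, t_{k-1})`. -/
def weightC {k : ℕ} (hk : 2 ≤ k) (t : Fin k → ℕ) : ℝ :=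
  coeffC (fun i : Fin (k - 1) => t ⟨i, by omega⟩)
    - coeffC (fun i : Fin (k - 2) => t ⟨i + 1, by omega⟩)

end MZV

end

open scoped ENNReal
open Finset

/-! Put `s_i = e_i + 1` and sum against `x ^ (∑ e_i)` for `0 < x < 1/2`. Geometric series turn the
weight `1` into poles `1/(m - x)` and the weight `2^e` into `1/(m - 2x)`. All terms are nonnegative,
so in `ℝ≥0∞` every rearrangement is free.

The heart is a regularised double shuffle (`tsum_shuffle_eq_tsum_stuffle`): a double sum over `p,
q`, built from `1/((p+1-x)(q+1-x))` with its divergent terms removed and multiplied by the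
elementary symmetric sum of the poles below `q`, is computed twice. Partial fractions with `(p+1-x)
+ (q+1-x) = p+q+2-2x` create the powers of 2, hence the weights `C`. Summing over `p` directly
creates a stuffle product `e_1 e_j`.

That product is `(j+1) e_{j+1}` plus terms with one squared pole, and squaring a pole amounts to
applying `x d/dx`. With `k = j + 2`, the right side is thus `k` times the unweighted generating
function in depth `k`, plus a degree-weighted one in depth `k - 1`. The classical sum formula,
proved by a connected sum (`tsum_pole_mul_pow`), evaluates them to `k ζ(n)` and `(n - k) ζ(n)`,
whose total is `n ζ(n)`. Comparing coefficients gives `weightedSum_eweight`. For `k = 2`, adding the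
sum formula once more gives Ohno–Zudilin. -/

namespace MZV

/-! ### Elementary symmetric sums: shuffle and stuffle recursions -/

section Semiring

variable {A : Type*} [CommSemiring A]

/-- The elementary symmetric sum `∑_{N > q_1 > ⋯ > q_j ≥ 0} f q_1 ⋯ f q_j`. -/
def elem (f : ℕ → A) : ℕ → ℕ → A
  | 0, _ => 1
  | j + 1, N => ∑ q ∈ range N, f q * elem f j q

/-- The sum of `f p * (f q_1 ⋯ f q_j)` over `p + q + 1 = N` and `q > q_1 > ⋯ > q_j ≥ 0`. -/
def shuffleSum (f : ℕ → A) (j N : ℕ) : A :=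
  ∑ q ∈ range N, f (N - 1 - q) * elem f j q

/-- The sum of all products obtained from those of `elem f j N` by replacing one factor `f q`
by `g q`. -/
def derivSum (f g : ℕ → A) : ℕ → ℕ → A
  | 0, _ => 0
  | j + 1, N => ∑ q ∈ range N, (g q * elem f j q + f q * derivSum f g j q)

theorem elem_succ_succ (f : ℕ → A) (j N : ℕ) :
    elem f (j + 1) (N + 1) = elem f (j + 1) N + f N * elem f j N := by
  simp [elem, sum_range_succ]

/-- Passing from `N` to `N + 1` and shifting `q`, the increment consists of the terms `f (N-1-q) * f
q * elem f j q`; `hb` splits each product, and the two halves sum to `shuffleSum f j N` and `elem f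
(j+1) N`. -/
theorem shuffleSum_succ {f b : ℕ → A}
    (hb : ∀ p q, b (p + q + 1) * (f p + f q) = f p * f q) (j N : ℕ) :
    shuffleSum f (j + 1) N =
      ∑ M ∈ range N, b M * (elem f (j + 1) M + shuffleSum f j M) := by
  induction N with
  | zero => simp [shuffleSum]
  | succ N ih =>
    rw [sum_range_succ, ← ih, shuffleSum, sum_range_succ']
    have h0 : elem f (j + 1) 0 = 0 := by simp [elem]
    rw [h0, mul_zero, add_zero, shuffleSum, shuffleSum]
    have h1 : elem f (j + 1) N = ∑ q ∈ range N, f q * elem f j q := rfl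
    rw [h1, ← sum_add_distrib, mul_sum, ← sum_add_distrib]
    refine sum_congr rfl fun q hq => ?_
    have hq' := mem_range.1 hq
    have e1 : N + 1 - 1 - (q + 1) = N - 1 - q := by omega
    have e2 := hb (N - 1 - q) q
    have e3 : N - 1 - q + q + 1 = N := by omega
    rw [e3] at e2
    rw [e1, elem_succ_succ, mul_add, ← add_mul, add_comm (f q), ← mul_assoc, ← mul_assoc, e2]

/-- Stuffle: the extra index is either new, so each product of `j + 1` factors arises `j + 1` times,
or equal to an old one, which squares a factor. The scalar `X` is carried along so that `g` can
later be `x d/dx` of a pole. -/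
theorem mul_elem_one_mul_elem {f g : ℕ → A} {X : A} (hg : ∀ q, g q = X * (f q * f q))
    (j N : ℕ) :
    X * (elem f 1 N * elem f j N) = (j + 1) * (X * elem f (j + 1) N) + derivSum f g j N := by
  induction N generalizing j with
  | zero =>
    cases j <;> simp [elem, derivSum]
  | succ N ih =>
    cases j with
    | zero => simp [elem, derivSum]
    | succ j =>
      have h1 : derivSum f g (j + 1) (N + 1)
          = derivSum f g (j + 1) N + (g N * elem f j N + f N * derivSum f g j N) := by
        simp [derivSum, sum_range_succ]
      have h2 := ih (j + 1)
      have h3 := ih j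
      have h4 : elem f 1 (N + 1) = elem f 1 N + f N := by
        simp [elem, sum_range_succ]
      rw [h1, hg, h4, elem_succ_succ, elem_succ_succ f (j + 1)]
      push_cast at h2 ⊢
      calc _ = X * (elem f 1 N * elem f (j + 1) N) + f N * (X * (elem f 1 N * elem f j N))
            + X * (f N * elem f (j + 1) N) + X * (f N * f N) * elem f j N := by ring
        _ = _ := by rw [h2, h3]; ring

end Semiring

/-! ### Poles and rearrangements of series -/

/-- `1 / (m + 1 - y)` as an extended nonnegative real. -/
noncomputable def pole (y : ℝ) (m : ℕ) : ℝ≥0∞ := ENNReal.ofReal (1 / ((m : ℝ) + 1 - y))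

theorem tsum_mul_sum_range (u v : ℕ → ℝ≥0∞) :
    ∑' n, u n * ∑ m ∈ range n, v m = ∑' m, v m * ∑' n, u (n + m + 1) := by
  have h : ∀ m, v m * ∑' n, u (n + m + 1) = ∑' n, if m < n then u n * v m else 0 := by
    intro m
    rw [← Summable.sum_add_tsum_nat_add' (f := fun n => if m < n then u n * v m else 0)
      (k := m + 1) ENNReal.summable, sum_eq_zero, zero_add, ← ENNReal.tsum_mul_left]
    · refine tsum_congr fun n => ?_
      rw [if_pos (by omega), mul_comm, add_assoc]
    · intro i hi
      rw [if_neg (by have := mem_range.1 hi; omega)]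
  simp_rw [h]
  rw [ENNReal.tsum_comm]
  refine tsum_congr fun n => ?_
  rw [tsum_eq_sum (s := range n), mul_sum]
  · exact sum_congr rfl fun m hm => by rw [if_pos (mem_range.1 hm)]
  · intro m hm
    rw [if_neg (by simpa using hm)]

/-- Summation over pairs `(p, q)`, sorted by `M = p + q + 1`. -/
theorem tsum_tsum_eq_tsum_sum_range (F : ℕ → ℕ → ℝ≥0∞) :
    ∑' q, ∑' p, F p q = ∑' M, ∑ q ∈ range M, F (M - 1 - q) q := by
  have h : ∀ q, ∑' p, F p q = ∑' M, if q < M then F (M - 1 - q) q else 0 := by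
    intro q
    rw [← Summable.sum_add_tsum_nat_add' (f := fun M => if q < M then F (M - 1 - q) q else 0)
      (k := q + 1) ENNReal.summable, sum_eq_zero, zero_add]
    · refine tsum_congr fun p => ?_
      rw [if_pos (by omega)]
      congr 1
      omega
    · intro i hi
      rw [if_neg (by have := mem_range.1 hi; omega)]
  simp_rw [h]
  rw [ENNReal.tsum_comm]
  refine tsum_congr fun n => ?_
  rw [tsum_eq_sum (s := range n)]
  · exact sum_congr rfl fun m hm => by rw [if_pos (mem_range.1 hm)]
  · intro m hm
    rw [if_neg (by simpa using hm)]

theorem tsum_ofReal_telescope {u : ℕ → ℝ} (hu : Antitone u)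
    (hlim : Filter.Tendsto u Filter.atTop (nhds 0)) (b : ℕ) :
    ∑' n, ENNReal.ofReal (u (n + b) - u (n + b + 1)) = ENNReal.ofReal (u b) := by
  have hs : HasSum (fun n => u (n + b) - u (n + b + 1)) (u b) := by
    rw [hasSum_iff_tendsto_nat_of_nonneg fun n => sub_nonneg.2 (hu (by omega))]
    have h1 : ∀ n, ∑ i ∈ range n, (u (i + b) - u (i + b + 1)) = u b - u (n + b) := by
      intro n
      have := sum_range_sub' (fun i => u (i + b)) n
      simpa [add_right_comm] using this
    simp_rw [h1]
    have := (hlim.comp (Filter.tendsto_add_atTop_nat b)).const_sub (u b)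
    simpa using this
  rw [← ENNReal.ofReal_tsum_of_nonneg (fun n => sub_nonneg.2 (hu (by omega))) hs.summable,
    hs.tsum_eq]

/-! ### Connected sums and the generating function of the sum formula -/

/-- The connector `f m f n / f (m + n)`, where `f m = ∏_{i=1}^m (i - x)`. -/
noncomputable def connector (x : ℝ) (m n : ℕ) : ℝ :=
  (∏ i ∈ range m, ((i : ℝ) + 1 - x)) * (∏ i ∈ range n, ((i : ℝ) + 1 - x))
    / ∏ i ∈ range (m + n), ((i : ℝ) + 1 - x)

theorem connector_comm (x : ℝ) (m n : ℕ) : connector x m n = connector x n m := by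
  rw [connector, connector, add_comm m n, mul_comm (∏ i ∈ range m, _)]

theorem factor_pos {x : ℝ} (hx : x < 1) (i : ℕ) : 0 < (i : ℝ) + 1 - x := by
  have : (0 : ℝ) ≤ i := i.cast_nonneg
  linarith

theorem prod_factor_pos {x : ℝ} (hx : x < 1) (m : ℕ) : 0 < ∏ i ∈ range m, ((i : ℝ) + 1 - x) :=
  prod_pos fun i _ => factor_pos hx i

theorem connector_pos {x : ℝ} (hx : x < 1) (m n : ℕ) : 0 < connector x m n :=
  div_pos (mul_pos (prod_factor_pos hx m) (prod_factor_pos hx n)) (prod_factor_pos hx _)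

theorem connector_zero_right {x : ℝ} (hx : x < 1) (m : ℕ) : connector x m 0 = 1 := by
  simp [connector, (prod_factor_pos hx m).ne']

theorem connector_succ_right {x : ℝ} (hx : x < 1) (m n : ℕ) :
    connector x m (n + 1) = connector x m n * (((n : ℝ) + 1 - x) / ((m : ℝ) + n + 1 - x)) := by
  have h1 := factor_pos hx (m + n)
  have h2 := prod_factor_pos hx (m + n)
  push_cast at h1
  rw [connector, connector, ← add_assoc, prod_range_succ _ n, prod_range_succ _ (m + n)]
  push_cast
  field_simp

theorem connector_sub {x : ℝ} (hx : x < 1) (m n : ℕ) :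
    connector x m n - connector x m (n + 1)
      = (m : ℝ) * (1 / ((n : ℝ) + 1 - x) * connector x m (n + 1)) := by
  have h1 := factor_pos hx (m + n)
  have h2 := factor_pos hx n
  push_cast at h1
  rw [connector_succ_right hx]
  field_simp
  ring

theorem connector_antitone {x : ℝ} (hx : x < 1) (m : ℕ) : Antitone (connector x m) := by
  refine antitone_nat_of_succ_le fun n => ?_
  have h1 := connector_sub hx m n
  have h2 := factor_pos hx n
  have h3 := connector_pos hx m (n + 1)
  have : 0 ≤ (m : ℝ) * (1 / ((n : ℝ) + 1 - x) * connector x m (n + 1)) := by positivity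
  linarith

theorem connector_tendsto {x : ℝ} (hx : x < 1) (m : ℕ) :
    Filter.Tendsto (connector x (m + 1)) Filter.atTop (nhds 0) := by
  have h1 : ∀ n : ℕ, connector x 1 n = (1 - x) / ((n : ℝ) + 1 - x) := by
    intro n
    have h2 := prod_factor_pos hx n
    rw [connector, add_comm 1 n, prod_range_succ _ n, range_one, prod_singleton]
    have := factor_pos hx n
    push_cast
    field_simp
    ring
  have h2 : Filter.Tendsto (fun n : ℕ => (1 - x) / ((n : ℝ) + 1 - x)) Filter.atTop (nhds 0) := by
    refine Filter.Tendsto.div_atTop tendsto_const_nhds ?_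
    simp_rw [add_sub_assoc]
    exact Filter.tendsto_atTop_add_const_right _ _ tendsto_natCast_atTop_atTop
  -- By symmetry the connector also decreases in its first argument, so the explicit case `1`
  -- dominates.
  refine squeeze_zero (fun n => (connector_pos hx _ n).le) (fun n => ?_) h2
  rw [← h1, connector_comm x _ n, connector_comm x _ n]
  exact connector_antitone hx n (by omega)

/-- The transport relation: by `connector_sub` the series telescopes. It trades a factor `1/(m+1)`
for a new summation index `≥ b` carrying a pole at `x`. -/
theorem tsum_pole_mul_connector {x : ℝ} (hx : x < 1) (m b : ℕ) :
    ∑' n, pole x (n + b) * ENNReal.ofReal (connector x (m + 1) (n + b + 1))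
      = pole 0 m * ENNReal.ofReal (connector x (m + 1) b) := by
  have h := tsum_ofReal_telescope (connector_antitone hx (m + 1)) (connector_tendsto hx m) b
  rw [← h, ← ENNReal.tsum_mul_left]
  refine tsum_congr fun n => ?_
  have h1 := factor_pos hx (n + b)
  rw [connector_sub hx, pole, pole, ← ENNReal.ofReal_mul (one_div_pos.2 h1).le,
    ← ENNReal.ofReal_mul (one_div_pos.2 (factor_pos zero_lt_one m)).le]
  congr 1
  push_cast
  field_simp
  ring

/-- Each factor `1/(m+1)` is transported in turn, starting from `connector x (m+1) 0 = 1`; every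
transport adds a new largest index. -/
theorem pole_zero_pow {x : ℝ} (hx : x < 1) (i m : ℕ) :
    pole 0 m ^ (i + 1)
      = ∑' n, pole x n * elem (pole x) i n * ENNReal.ofReal (connector x (m + 1) (n + 1)) := by
  induction i with
  | zero =>
    have := tsum_pole_mul_connector hx m 0
    simp only [add_zero, connector_zero_right hx, ENNReal.ofReal_one, mul_one] at this
    simp [elem, this]
  | succ i ih =>
    rw [pow_succ, ih, ← ENNReal.tsum_mul_right]
    have h := tsum_mul_sum_range
      (fun n => pole x n * ENNReal.ofReal (connector x (m + 1) (n + 1)))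
      (fun n => pole x n * elem (pole x) i n)
    have h2 : ∀ n, pole x n * elem (pole x) (i + 1) n
        * ENNReal.ofReal (connector x (m + 1) (n + 1))
        = pole x n * ENNReal.ofReal (connector x (m + 1) (n + 1))
          * ∑ q ∈ range n, pole x q * elem (pole x) i q := by
      intro n
      rw [elem]; ring
    simp_rw [h2]
    rw [h]
    refine tsum_congr fun n => ?_
    have h3 := tsum_pole_mul_connector hx m (n + 1)
    simp only [← add_assoc] at h3
    rw [h3]
    ring

/-- The generating function of the sum formula. -/
theorem tsum_pole_mul_pow {x : ℝ} (hx : x < 1) (i : ℕ) :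
    ∑' m, pole x m * pole 0 m ^ (i + 1) = ∑' n, pole 0 n * pole x n * elem (pole x) i n := by
  simp_rw [pole_zero_pow hx i, ← ENNReal.tsum_mul_left]
  -- With the sums exchanged, the symmetry of the connector lets the same transport relation sum
  -- over `m`, leaving `pole 0 n`.
  rw [ENNReal.tsum_comm]
  refine tsum_congr fun n => ?_
  have h := tsum_pole_mul_connector hx n 0
  simp only [add_zero, connector_zero_right hx, ENNReal.ofReal_one, mul_one] at h
  rw [← h, mul_assoc, ← ENNReal.tsum_mul_right]
  refine tsum_congr fun m => ?_
  rw [connector_comm x (n + 1)]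
  ring

/-! ### The regularised double shuffle relation -/

/-- `1 / (m + 1 - y) - 1 / (m + 1 - z)` as an extended nonnegative real. -/
noncomputable def poleSub (y z : ℝ) (m : ℕ) : ℝ≥0∞ :=
  ENNReal.ofReal (1 / ((m : ℝ) + 1 - y) - 1 / ((m : ℝ) + 1 - z))

theorem one_div_sub_one_div_nonneg {y z : ℝ} (hzy : z ≤ y) (hy : y < 1) (m : ℕ) :
    0 ≤ 1 / ((m : ℝ) + 1 - y) - 1 / ((m : ℝ) + 1 - z) := by
  have h1 := factor_pos hy m
  exact sub_nonneg.2 (one_div_le_one_div_of_le h1 (by linarith))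

theorem pole_add_poleSub {y z : ℝ} (hzy : z ≤ y) (hy : y < 1) (m : ℕ) :
    pole z m + poleSub y z m = pole y m := by
  have h1 := factor_pos (hzy.trans_lt hy) m
  rw [pole, poleSub, pole, ← ENNReal.ofReal_add (one_div_pos.2 h1).le
    (one_div_sub_one_div_nonneg hzy hy m)]
  congr 1
  ring

theorem pole_two_mul {x : ℝ} (hx : 2 * x < 1) (p q : ℕ) :
    pole (2 * x) (p + q + 1) * (pole x p + pole x q) = pole x p * pole x q := by
  have hx1 : x < 1 := by linarith
  have h1 := factor_pos hx1 p
  have h2 := factor_pos hx1 q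
  have h3 := factor_pos hx (p + q + 1)
  rw [pole, pole, pole, ← ENNReal.ofReal_add (one_div_pos.2 h1).le (one_div_pos.2 h2).le,
    ← ENNReal.ofReal_mul (one_div_pos.2 h3).le, ← ENNReal.ofReal_mul (one_div_pos.2 h1).le]
  congr 1
  push_cast at h3 ⊢
  field_simp
  ring

theorem poleSub_zero {x : ℝ} (hx0 : 0 ≤ x) (hx : x < 1) (m : ℕ) :
    poleSub x 0 m = ENNReal.ofReal x * (pole 0 m * pole x m) := by
  have h1 := factor_pos hx m
  have h2 := factor_pos zero_lt_one m
  rw [poleSub, pole, pole, ← ENNReal.ofReal_mul (one_div_pos.2 h2).le, ← ENNReal.ofReal_mul hx0]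
  congr 1
  field_simp
  ring

/-- `1 / (p + 1 - x) - 1 / (p + q + 2)` as an extended nonnegative real. -/
noncomputable def shiftSub (x : ℝ) (p q : ℕ) : ℝ≥0∞ :=
  ENNReal.ofReal (1 / ((p : ℝ) + 1 - x) - 1 / ((p : ℝ) + q + 2))

/-- Inserting `1/(p+1)` splits off a telescoping series with sum `∑_{p ≤ q} 1/(p+1)`; this completes
the first `q + 1` terms of `poleSub x 0` to full poles at `x`. -/
theorem tsum_shiftSub {x : ℝ} (hx0 : 0 ≤ x) (hx : x < 1) (q : ℕ) :
    ∑' p, shiftSub x p q = ∑ p ∈ range (q + 1), pole x p + ∑' p, poleSub x 0 (p + (q + 1)) := by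
  have hnn : ∀ p : ℕ, 0 ≤ 1 / ((p : ℝ) + 1 - 0) - 1 / ((p : ℝ) + q + 2) := fun p =>
    sub_nonneg.2 (one_div_le_one_div_of_le (factor_pos zero_lt_one p)
      (by have : (0 : ℝ) ≤ q := q.cast_nonneg
          linarith))
  have h1 : ∀ p, shiftSub x p q = poleSub x 0 p
      + ENNReal.ofReal (1 / ((p : ℝ) + 1 - 0) - 1 / ((p : ℝ) + q + 2)) := by
    intro p
    rw [shiftSub, poleSub, ← ENNReal.ofReal_add (one_div_sub_one_div_nonneg hx0 hx p) (hnn p)]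
    congr 1
    ring
  have h2 : ∑' p : ℕ, ENNReal.ofReal (1 / ((p : ℝ) + 1 - 0) - 1 / ((p : ℝ) + q + 2))
      = ∑ p ∈ range (q + 1), pole 0 p := by
    have hs : HasSum (fun p : ℕ => 1 / ((p : ℝ) + 1 - 0) - 1 / ((p : ℝ) + q + 2))
        (∑ p ∈ range (q + 1), 1 / ((p : ℝ) + 1 - 0)) := by
      rw [hasSum_iff_tendsto_nat_of_nonneg hnn]
      have h3 : ∀ n : ℕ, ∑ i ∈ range n, (1 / ((i : ℝ) + 1 - 0) - 1 / ((i : ℝ) + q + 2))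
          = ∑ i ∈ range (q + 1), 1 / ((i : ℝ) + 1 - 0)
            - ∑ i ∈ range (q + 1), 1 / ((n : ℝ) + i + 1) := by
        intro n
        have e1 := sum_range_add (fun i : ℕ => 1 / ((i : ℝ) + 1)) n (q + 1)
        have e2 := sum_range_add (fun i : ℕ => 1 / ((i : ℝ) + 1)) (q + 1) n
        rw [add_comm (q + 1) n, e1] at e2
        rw [sum_sub_distrib]
        have e3 : ∑ i ∈ range n, 1 / ((i : ℝ) + q + 2)
            = ∑ i ∈ range n, 1 / (((q + 1 + i : ℕ) : ℝ) + 1) :=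
          sum_congr rfl fun i _ => by push_cast; ring
        simp only [sub_zero]
        push_cast at e2 e3
        rw [e3]
        linarith
      simp_rw [h3]
      have h4 : Filter.Tendsto (fun n : ℕ => ∑ i ∈ range (q + 1), 1 / ((n : ℝ) + i + 1))
          Filter.atTop (nhds (∑ i ∈ range (q + 1), 0)) := by
        refine tendsto_finsetSum _ fun i _ => ?_
        refine Filter.Tendsto.div_atTop tendsto_const_nhds ?_
        simp_rw [add_assoc]
        exact Filter.tendsto_atTop_add_const_right _ _ tendsto_natCast_atTop_atTop
      simpa using h4.const_sub (∑ i ∈ range (q + 1), 1 / ((i : ℝ) + 1 - 0))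
    rw [← ENNReal.ofReal_tsum_of_nonneg hnn hs.summable, hs.tsum_eq,
      ENNReal.ofReal_sum_of_nonneg fun i _ => (one_div_pos.2 (factor_pos zero_lt_one i)).le]
    rfl
  simp_rw [h1]
  rw [ENNReal.tsum_add, h2, ← Summable.sum_add_tsum_nat_add' (f := poleSub x 0)
    (k := q + 1) ENNReal.summable, add_right_comm, ← sum_add_distrib]
  congr 1
  exact sum_congr rfl fun p _ => by rw [add_comm, pole_add_poleSub hx0 hx]

/-- The partial fraction decomposition of `1 / ((p + 1 - x) * (q + 1 - x))`, without the terms of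
order zero in the largest variable. -/
theorem shiftSub_mul_add {x : ℝ} (hx0 : 0 ≤ x) (hx : 2 * x < 1) (p q : ℕ) :
    shiftSub x p q * poleSub x 0 q + poleSub x 0 (p + q + 1) * pole 0 q
      = poleSub (2 * x) x (p + q + 1) * pole x p
        + poleSub (2 * x) 0 (p + q + 1) * pole x q := by
  have hx1 : x < 1 := by linarith
  have h1 := factor_pos hx1 p
  have h2 := factor_pos hx1 q
  have h3 := factor_pos hx (p + q + 1)
  have h4 := factor_pos hx1 (p + q + 1)
  have h5 := factor_pos zero_lt_one (p + q + 1)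
  have h6 := factor_pos zero_lt_one q
  have hu : 0 ≤ 1 / ((p : ℝ) + 1 - x) - 1 / ((p : ℝ) + q + 2) :=
    sub_nonneg.2 (one_div_le_one_div_of_le h1
      (by have : (0 : ℝ) ≤ q := q.cast_nonneg
          linarith))
  have n1 := one_div_sub_one_div_nonneg hx0 hx1 q
  have n2 := one_div_sub_one_div_nonneg hx0 hx1 (p + q + 1)
  have n3 := one_div_sub_one_div_nonneg (show x ≤ 2 * x by linarith) hx (p + q + 1)
  have n4 := one_div_sub_one_div_nonneg (show 0 ≤ 2 * x by linarith) hx (p + q + 1)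
  simp only [shiftSub, poleSub, pole]
  rw [← ENNReal.ofReal_mul hu, ← ENNReal.ofReal_mul n2, ← ENNReal.ofReal_mul n3,
    ← ENNReal.ofReal_mul n4,
    ← ENNReal.ofReal_add (mul_nonneg hu n1) (mul_nonneg n2 (one_div_pos.2 h6).le),
    ← ENNReal.ofReal_add (mul_nonneg n3 (one_div_pos.2 h1).le)
      (mul_nonneg n4 (one_div_pos.2 h2).le)]
  congr 1
  -- In terms of `P = p+1-x` and `Q = q+1-x` the other denominators are `P+Q`, `P+Q+x`, `P+Q+2x` and
  -- `Q+x`, so a rational identity remains.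
  have e1 : ((p + q + 1 : ℕ) : ℝ) + 1 - 2 * x = (p + 1 - x) + (q + 1 - x) := by push_cast; ring
  have e2 : ((p + q + 1 : ℕ) : ℝ) + 1 - x = (p + 1 - x) + (q + 1 - x) + x := by push_cast; ring
  have e3 : ((p + q + 1 : ℕ) : ℝ) + 1 - 0 = (p + 1 - x) + (q + 1 - x) + 2 * x := by
    push_cast; ring
  have e4 : (p : ℝ) + q + 2 = (p + 1 - x) + (q + 1 - x) + 2 * x := by ring
  have e5 : (q : ℝ) + 1 - 0 = q + 1 - x + x := by ring
  rw [e1, e2, e3, e4, e5]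
  generalize (p : ℝ) + 1 - x = P at *
  generalize (q : ℝ) + 1 - x = Q at *
  field_simp
  ring

/-- The double shuffle relation for the generating functions. -/
theorem tsum_shuffle_eq_tsum_stuffle {x : ℝ} (hx0 : 0 ≤ x) (hx : 2 * x < 1) (j : ℕ) :
    ∑' M, poleSub (2 * x) x M * shuffleSum (pole x) j M
        + ∑' M, poleSub (2 * x) 0 M * elem (pole x) (j + 1) M
      = ∑' M, poleSub x 0 M * elem (pole x) (j + 1) M
        + ∑' q, poleSub x 0 q * elem (pole x) j q * elem (pole x) 1 (q + 1) := by
  have hx1 : x < 1 := by linarith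
  -- Shuffle side: group by `M = p + q + 1` and use partial fractions.
  have h1 : ∑' q, ∑' p, (shiftSub x p q * poleSub x 0 q + poleSub x 0 (p + q + 1) * pole 0 q)
        * elem (pole x) j q
      = ∑' M, poleSub (2 * x) x M * shuffleSum (pole x) j M
        + ∑' M, poleSub (2 * x) 0 M * elem (pole x) (j + 1) M := by
    rw [tsum_tsum_eq_tsum_sum_range, ← ENNReal.tsum_add]
    refine tsum_congr fun M => ?_
    rw [shuffleSum, elem, mul_sum, mul_sum, ← sum_add_distrib]
    refine sum_congr rfl fun q hq => ?_
    have e : M - 1 - q + q + 1 = M := by have := mem_range.1 hq; omega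
    rw [shiftSub_mul_add hx0 hx, e]
    ring
  -- Stuffle side: sum over `p` first.
  have h2 : ∑' q, ∑' p, (shiftSub x p q * poleSub x 0 q + poleSub x 0 (p + q + 1) * pole 0 q)
        * elem (pole x) j q
      = ∑' q, poleSub x 0 q * elem (pole x) j q * ∑' p, shiftSub x p q
        + ∑' q, pole 0 q * elem (pole x) j q * ∑' p, poleSub x 0 (p + q + 1) := by
    rw [← ENNReal.tsum_add]
    refine tsum_congr fun q => ?_
    rw [← ENNReal.tsum_mul_left, ← ENNReal.tsum_mul_left, ← ENNReal.tsum_add]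
    exact tsum_congr fun p => by ring
  have h3 : ∑' M, poleSub x 0 M * elem (pole x) (j + 1) M
      = ∑' q, pole x q * elem (pole x) j q * ∑' p, poleSub x 0 (p + q + 1) :=
    tsum_mul_sum_range _ _
  rw [← h1, h2, h3, ← ENNReal.tsum_add, ← ENNReal.tsum_add]
  refine tsum_congr fun q => ?_
  have h4 : elem (pole x) 1 (q + 1) = ∑ p ∈ range (q + 1), pole x p := by simp [elem]
  rw [tsum_shiftSub hx0 hx1, ← pole_add_poleSub hx0 hx1 q, h4]
  simp only [← add_assoc]
  ring

theorem tsum_shuffle_eq {x : ℝ} (hx0 : 0 ≤ x) (hx : 2 * x < 1) (j : ℕ) {g : ℕ → ℝ≥0∞}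
    (hg : ∀ q, g q = ENNReal.ofReal x * (pole x q * pole x q)) :
    ∑' M, poleSub (2 * x) x M * shuffleSum (pole x) j M
        + ∑' M, poleSub (2 * x) 0 M * elem (pole x) (j + 1) M
      = (j + 2) * ∑' M, poleSub x 0 M * elem (pole x) (j + 1) M
        + ∑' q, pole 0 q * (g q * elem (pole x) j q + pole x q * derivSum (pole x) g j q) := by
  have hx1 : x < 1 := by linarith
  have h1 : ((j : ℝ≥0∞) + 2) = 1 + (j + 1) := by ring
  rw [tsum_shuffle_eq_tsum_stuffle hx0 hx, h1, add_mul, one_mul, add_assoc]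
  congr 1
  rw [← ENNReal.tsum_mul_left, ← ENNReal.tsum_add]
  refine tsum_congr fun q => ?_
  have h2 := mul_elem_one_mul_elem hg j q
  have h3 : elem (pole x) 1 (q + 1) = elem (pole x) 1 q + pole x q := by
    simp [elem, sum_range_succ]
  rw [h3, poleSub_zero hx0 hx1, hg]
  calc _ = pole 0 q * pole x q
          * (ENNReal.ofReal x * (elem (pole x) 1 q * elem (pole x) j q))
        + pole 0 q * (ENNReal.ofReal x * (pole x q * pole x q) * elem (pole x) j q) := by ring
    _ = _ := by rw [h2]; ring

/-! ### Generating functions of multiple zeta values -/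

/-- The sum `∑_{N > m_1 > ⋯ > m_k ≥ 0} ∏ (m_i + 1) ^ (-s_i)`. -/
noncomputable def harmonicSum : (k : ℕ) → (Fin k → ℕ) → ℕ → ℝ≥0∞
  | 0, _, _ => 1
  | k + 1, s, N => ∑ m ∈ range N, pole 0 m ^ s 0 * harmonicSum k (Fin.tail s) m

/-- The multiple zeta value of positive depth as an extended nonnegative real. -/
noncomputable def emzv {k : ℕ} (s : Fin (k + 1) → ℕ) : ℝ≥0∞ :=
  ∑' m, pole 0 m ^ s 0 * harmonicSum k (Fin.tail s) m

/-- The generating function of the truncated multiple zeta values with weights `Φ`. -/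
noncomputable def truncGF (X : ℝ≥0∞) {k : ℕ} (Φ : (Fin k → ℕ) → ℝ≥0∞) (N : ℕ) : ℝ≥0∞ :=
  ∑' e : Fin k → ℕ, Φ e * X ^ (∑ i, e i) * harmonicSum k (fun i => e i + 1) N

/-- The generating function of the multiple zeta values with weights `Ψ`. -/
noncomputable def mzvGF (X : ℝ≥0∞) {k : ℕ} (Ψ : (Fin (k + 1) → ℕ) → ℝ≥0∞) : ℝ≥0∞ :=
  ∑' e : Fin (k + 1) → ℕ, Ψ e * X ^ (∑ i, e i) * emzv (fun i => e i + 1)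

/-- The generating function of the powers of `1 / (m + 1)` with weights `φ`. -/
noncomputable def poleGF (X : ℝ≥0∞) (φ : ℕ → ℝ≥0∞) (m : ℕ) : ℝ≥0∞ :=
  ∑' a, φ a * X ^ a * pole 0 m ^ (a + 1)

theorem tsum_fin_succ {k : ℕ} (F : (Fin (k + 1) → ℕ) → ℝ≥0∞) :
    ∑' e, F e = ∑' a : ℕ, ∑' e : Fin k → ℕ, F (Fin.cons a e) := by
  rw [← (Fin.consEquiv fun _ : Fin (k + 1) => ℕ).tsum_eq F, ENNReal.tsum_prod']
  rfl

/-- A weight that splits off its first entry makes the generating function factor at each fixed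
largest index; depth recursions then reduce to one-variable series. -/
theorem tsum_cons_mul {X : ℝ≥0∞} {k : ℕ} {Ψ : (Fin (k + 1) → ℕ) → ℝ≥0∞} {φ : ℕ → ℝ≥0∞}
    {Φ : (Fin k → ℕ) → ℝ≥0∞} (h : ∀ a e, Ψ (Fin.cons a e) = φ a * Φ e) (m : ℕ) :
    ∑' e : Fin (k + 1) → ℕ, Ψ e * X ^ (∑ i, e i)
        * (pole 0 m ^ (e 0 + 1) * harmonicSum k (Fin.tail fun i => e i + 1) m)
      = poleGF X φ m * truncGF X Φ m := by
  rw [tsum_fin_succ, poleGF, ← ENNReal.tsum_mul_right]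
  refine tsum_congr fun a => ?_
  rw [truncGF, ← ENNReal.tsum_mul_left]
  refine tsum_congr fun e => ?_
  have e1 : (Fin.tail fun i : Fin (k + 1) => (Fin.cons a e : Fin (k + 1) → ℕ) i + 1)
      = fun i => e i + 1 := by
    funext i; simp [Fin.tail]
  rw [h, e1, Fin.sum_univ_succ]
  simp only [Fin.cons_zero, Fin.cons_succ, pow_add]
  ring

theorem truncGF_cons {X : ℝ≥0∞} {k : ℕ} {Ψ : (Fin (k + 1) → ℕ) → ℝ≥0∞} {φ : ℕ → ℝ≥0∞}
    {Φ : (Fin k → ℕ) → ℝ≥0∞} (h : ∀ a e, Ψ (Fin.cons a e) = φ a * Φ e) (N : ℕ) :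
    truncGF X Ψ N = ∑ m ∈ range N, poleGF X φ m * truncGF X Φ m := by
  simp_rw [← tsum_cons_mul h]
  rw [← Summable.tsum_finsetSum fun _ _ => ENNReal.summable]
  simp only [truncGF, harmonicSum, mul_sum]

theorem mzvGF_cons {X : ℝ≥0∞} {k : ℕ} {Ψ : (Fin (k + 1) → ℕ) → ℝ≥0∞} {φ : ℕ → ℝ≥0∞}
    {Φ : (Fin k → ℕ) → ℝ≥0∞} (h : ∀ a e, Ψ (Fin.cons a e) = φ a * Φ e) :
    mzvGF X Ψ = ∑' m, poleGF X φ m * truncGF X Φ m := by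
  simp_rw [← tsum_cons_mul h]
  rw [ENNReal.tsum_comm]
  simp only [mzvGF, emzv, ENNReal.tsum_mul_left]

theorem truncGF_add (X : ℝ≥0∞) {k : ℕ} (Φ Φ' : (Fin k → ℕ) → ℝ≥0∞) (N : ℕ) :
    truncGF X (fun e => Φ e + Φ' e) N = truncGF X Φ N + truncGF X Φ' N := by
  simp only [truncGF, add_mul, ENNReal.tsum_add]

theorem mzvGF_add (X : ℝ≥0∞) {k : ℕ} (Φ Φ' : (Fin (k + 1) → ℕ) → ℝ≥0∞) :
    mzvGF X (fun e => Φ e + Φ' e) = mzvGF X Φ + mzvGF X Φ' := by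
  simp only [mzvGF, add_mul, ENNReal.tsum_add]

theorem poleGF_add (X : ℝ≥0∞) (φ ψ : ℕ → ℝ≥0∞) (m : ℕ) :
    poleGF X (fun a => φ a + ψ a) m = poleGF X φ m + poleGF X ψ m := by
  simp only [poleGF, add_mul, ENNReal.tsum_add]

/-! ### One-variable weights and their poles -/

theorem hasSum_pole {y : ℝ} (hy0 : 0 ≤ y) (hy : y < 1) (m : ℕ) :
    HasSum (fun a => y ^ a * (1 / ((m : ℝ) + 1)) ^ (a + 1)) (1 / ((m : ℝ) + 1 - y)) := by
  have h1 := factor_pos hy m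
  have h2 : (0 : ℝ) < m + 1 := by positivity
  have h := (hasSum_geometric_of_lt_one (r := y / ((m : ℝ) + 1)) (by positivity)
    ((div_lt_one h2).2 (by linarith))).mul_left (1 / ((m : ℝ) + 1))
  have e1 : ∀ a : ℕ, y ^ a * (1 / ((m : ℝ) + 1)) ^ (a + 1)
      = 1 / ((m : ℝ) + 1) * (y / ((m : ℝ) + 1)) ^ a := by
    intro a
    rw [div_eq_mul_one_div y]
    ring
  have e2 : 1 / ((m : ℝ) + 1 - y) = 1 / ((m : ℝ) + 1) * (1 - y / ((m : ℝ) + 1))⁻¹ := by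
    rw [one_sub_div h2.ne']
    field_simp
  simp_rw [e1, e2]
  exact h

theorem pole_ne_top (y : ℝ) (m : ℕ) : pole y m ≠ ∞ := ENNReal.ofReal_ne_top

/-- Dropping `a = 0`, which encodes `s_1 ≥ 2`, removes exactly `pole 0 m`; the subtraction is a
cancellation of this finite term. -/
theorem poleGF_ite {x : ℝ} {φ : ℕ → ℝ≥0∞} (h0 : φ 0 = 1) {y : ℝ} (hy0 : 0 ≤ y) (hy : y < 1) {m : ℕ}
    (h : poleGF (ENNReal.ofReal x) φ m = pole y m) :
    poleGF (ENNReal.ofReal x) (fun a => if a = 0 then 0 else φ a) m = poleSub y 0 m := by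
  have h1 := poleGF_add (ENNReal.ofReal x) (fun a => if a = 0 then 1 else 0)
    (fun a => if a = 0 then 0 else φ a) m
  have e : (fun a : ℕ => (if a = 0 then 1 else 0 : ℝ≥0∞) + (if a = 0 then 0 else φ a)) = φ := by
    funext a
    split_ifs with ha
    · rw [ha, h0, add_zero]
    · rw [zero_add]
  have e2 : poleGF (ENNReal.ofReal x) (fun a => if a = 0 then 1 else 0) m = pole 0 m := by
    rw [poleGF, tsum_eq_single 0]
    · simp
    · intro a ha
      simp [ha]
  rw [e, e2, h, ← pole_add_poleSub hy0 hy] at h1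
  exact ((ENNReal.add_right_inj (pole_ne_top 0 m)).1 h1).symm

theorem poleGF_eq_of_hasSum {x : ℝ} (hx0 : 0 ≤ x) {φ : ℕ → ℝ} (hφ : ∀ a, 0 ≤ φ a) {m : ℕ} {v : ℝ}
    (h : HasSum (fun a => φ a * x ^ a * (1 / ((m : ℝ) + 1)) ^ (a + 1)) v) :
    poleGF (ENNReal.ofReal x) (fun a => ENNReal.ofReal (φ a)) m = ENNReal.ofReal v := by
  have hm : (0 : ℝ) ≤ 1 / ((m : ℝ) + 1) := by positivity
  have h0 : ∀ a, 0 ≤ φ a * x ^ a * (1 / ((m : ℝ) + 1)) ^ (a + 1) := fun a =>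
    mul_nonneg (mul_nonneg (hφ a) (by positivity)) (by positivity)
  rw [← h.tsum_eq, ENNReal.ofReal_tsum_of_nonneg h0 h.summable, poleGF]
  refine tsum_congr fun a => ?_
  rw [ENNReal.ofReal_mul (mul_nonneg (hφ a) (by positivity)), ENNReal.ofReal_mul (hφ a),
    ENNReal.ofReal_pow hx0, ENNReal.ofReal_pow hm, pole, sub_zero]

theorem poleGF_one {x : ℝ} (hx0 : 0 ≤ x) (hx : x < 1) (m : ℕ) :
    poleGF (ENNReal.ofReal x) (fun _ => 1) m = pole x m := by
  have := poleGF_eq_of_hasSum hx0 (φ := fun _ => 1) (fun _ => zero_le_one) (m := m)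
    (by simpa using hasSum_pole hx0 hx m)
  simpa [pole] using this

theorem poleGF_two_pow {x : ℝ} (hx0 : 0 ≤ x) (hx : 2 * x < 1) (m : ℕ) :
    poleGF (ENNReal.ofReal x) (fun a => 2 ^ a) m = pole (2 * x) m := by
  have h := hasSum_pole (by positivity) hx m
  simp_rw [mul_pow] at h
  have := poleGF_eq_of_hasSum hx0 (φ := fun a => 2 ^ a) (fun _ => by positivity) h
  simpa [ENNReal.ofReal_pow, pole] using this

theorem poleGF_two_pow_sub_one {x : ℝ} (hx0 : 0 ≤ x) (hx : 2 * x < 1) (m : ℕ) :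
    poleGF (ENNReal.ofReal x) (fun a => 2 ^ a - 1) m = poleSub (2 * x) x m := by
  have hx1 : x < 1 := by linarith
  have h := poleGF_add (ENNReal.ofReal x) (fun _ => 1) (fun a => 2 ^ a - 1) m
  have e : (fun a : ℕ => (1 : ℝ≥0∞) + (2 ^ a - 1)) = fun a => 2 ^ a := by
    funext a
    exact add_tsub_cancel_of_le (one_le_pow₀ one_le_two)
  rw [e, poleGF_two_pow hx0 hx, poleGF_one hx0 hx1,
    ← pole_add_poleSub (show x ≤ 2 * x by linarith) hx] at h
  exact ((ENNReal.add_right_inj (pole_ne_top x m)).1 h).symm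

theorem poleGF_natCast {x : ℝ} (hx0 : 0 ≤ x) (hx : x < 1) (m : ℕ) :
    poleGF (ENNReal.ofReal x) (fun a => (a : ℝ≥0∞)) m
      = ENNReal.ofReal x * (pole x m * pole x m) := by
  have h1 := factor_pos hx m
  have h2 : (0 : ℝ) < m + 1 := by positivity
  have hr : x / ((m : ℝ) + 1) < 1 := (div_lt_one h2).2 (by linarith)
  have hn : ‖x / ((m : ℝ) + 1)‖ < 1 := by
    rwa [Real.norm_of_nonneg (by positivity)]
  have h := (hasSum_coe_mul_geometric_of_norm_lt_one hn).mul_left (1 / ((m : ℝ) + 1))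
  have h' : HasSum (fun a : ℕ => (a : ℝ) * x ^ a * (1 / ((m : ℝ) + 1)) ^ (a + 1))
      (x * (1 / ((m : ℝ) + 1 - x) * (1 / ((m : ℝ) + 1 - x)))) := by
    have e1 : ∀ a : ℕ, (a : ℝ) * x ^ a * (1 / ((m : ℝ) + 1)) ^ (a + 1)
        = 1 / ((m : ℝ) + 1) * (a * (x / ((m : ℝ) + 1)) ^ a) := by
      intro a
      rw [div_eq_mul_one_div x]
      ring
    have e2 : x * (1 / ((m : ℝ) + 1 - x) * (1 / ((m : ℝ) + 1 - x)))
        = 1 / ((m : ℝ) + 1) * (x / ((m : ℝ) + 1) / (1 - x / ((m : ℝ) + 1)) ^ 2) := by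
      rw [one_sub_div h2.ne']
      field_simp
    simp_rw [e1, e2]
    exact h
  have := poleGF_eq_of_hasSum hx0 (fun a => a.cast_nonneg) h'
  simp only [ENNReal.ofReal_natCast] at this
  rw [this, pole, ENNReal.ofReal_mul hx0, ENNReal.ofReal_mul (one_div_pos.2 h1).le]

theorem poleGF_pred {x : ℝ} (hx0 : 0 ≤ x) (hx : x < 1) (m : ℕ) :
    poleGF (ENNReal.ofReal x) (fun a => ((a - 1 : ℕ) : ℝ≥0∞)) m
      = ENNReal.ofReal x * pole 0 m * (ENNReal.ofReal x * (pole x m * pole x m)) := by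
  rw [← poleGF_natCast hx0 hx, poleGF, tsum_eq_zero_add' ENNReal.summable, poleGF,
    ← ENNReal.tsum_mul_left]
  simp only [zero_tsub, Nat.cast_zero, zero_mul, zero_add, add_tsub_cancel_right]
  exact tsum_congr fun a => by ring

/-! ### Comparison of power series coefficients -/

theorem hasFPowerSeriesAt_ofScalars {c : ℕ → ℝ} {r : ℝ} (hr : 0 < r)
    (hc : Summable fun n => c n * r ^ n) :
    HasFPowerSeriesAt (FormalMultilinearSeries.ofScalars ℝ c).sum
      (FormalMultilinearSeries.ofScalars ℝ c) (0 : ℝ) := by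
  have h : (r.toNNReal : ℝ≥0∞) ≤ (FormalMultilinearSeries.ofScalars ℝ c).radius := by
    refine FormalMultilinearSeries.le_radius_of_tendsto _ (l := 0) ?_
    have := hc.tendsto_atTop_zero.norm
    simp only [norm_zero] at this
    refine this.congr fun n => ?_
    rw [FormalMultilinearSeries.ofScalars_norm, Real.coe_toNNReal _ hr.le, norm_mul, norm_pow,
      Real.norm_of_nonneg hr.le]
  refine (FormalMultilinearSeries.hasFPowerSeriesOnBall _ ?_).hasFPowerSeriesAt
  exact lt_of_lt_of_le (by simpa using hr) h

/-- The zeros in `(0, r]` accumulate at `0`, so the identity theorem applies although only positive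
`x` are available. -/
theorem eq_zero_of_hasSum_pow {c : ℕ → ℝ} {r : ℝ} (hr : 0 < r)
    (hc : ∀ x : ℝ, 0 < x → x ≤ r → HasSum (fun n => c n * x ^ n) 0) (n : ℕ) : c n = 0 := by
  have h := hasFPowerSeriesAt_ofScalars hr (hc r hr le_rfl).summable
  have h1 : ∀ x ∈ Set.Ioc 0 r, (FormalMultilinearSeries.ofScalars ℝ c).sum x = (0 : ℝ) := by
    intro x hx
    change FormalMultilinearSeries.ofScalarsSum c x = 0
    rw [FormalMultilinearSeries.ofScalars_sum_eq]
    simpa using (hc x hx.1 hx.2).tsum_eq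
  have h2 : ∃ᶠ x in nhdsWithin (0 : ℝ) {0}ᶜ,
      (FormalMultilinearSeries.ofScalars ℝ c).sum x = (0 : ℝ) := by
    have h3 : ∃ᶠ x in nhdsWithin (0 : ℝ) (Set.Ioi 0),
        (FormalMultilinearSeries.ofScalars ℝ c).sum x = (0 : ℝ) := by
      refine Filter.Eventually.frequently ?_
      filter_upwards [Ioc_mem_nhdsGT hr] with x hx using h1 x hx
    exact h3.filter_mono (nhdsWithin_mono _ fun x hx => ne_of_gt hx)
  have h4 := (h.analyticAt.frequently_eq_iff_eventually_eq analyticAt_const).1 h2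
  have h5 : HasFPowerSeriesAt (0 : ℝ → ℝ) (FormalMultilinearSeries.ofScalars ℝ c) 0 :=
    h.congr h4
  have h6 := h5.eq_zero
  rw [FormalMultilinearSeries.ofScalars_series_eq_zero] at h6
  exact congr_fun h6 n

theorem tsum_pow_mul_succ_ne_top {X : ℝ≥0∞} (hX : X < 1) :
    ∑' d : ℕ, X ^ d * (d + 1) ≠ ∞ := by
  lift X to NNReal using (hX.trans ENNReal.one_lt_top).ne
  have hX' : (X : ℝ) < 1 := by exact_mod_cast hX
  have h : Summable fun d : ℕ => X ^ d * (d + 1) := by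
    rw [← NNReal.summable_coe]
    push_cast
    have h1 : Summable fun d : ℕ => (d : ℝ) * (X : ℝ) ^ d :=
      (hasSum_coe_mul_geometric_of_norm_lt_one (by simpa using hX')).summable
    have h2 : Summable fun d : ℕ => (X : ℝ) ^ d := summable_geometric_of_lt_one X.2 hX'
    refine (h1.add h2).congr fun d => by ring
  have := ENNReal.tsum_coe_ne_top_iff_summable.2 h
  push_cast at this
  exact this

/-- Comparison of the coefficients of power series with nonnegative coefficients. -/
theorem eq_of_tsum_pow_mul_eq {A B : ℕ → ℝ≥0∞} {C : ℝ≥0∞} (hC : C ≠ ∞)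
    (hB : ∀ d, B d ≤ C * (d + 1))
    (h : ∀ x : ℝ, 0 < x → 2 * x < 1 →
      ∑' d, ENNReal.ofReal x ^ d * A d = ∑' d, ENNReal.ofReal x ^ d * B d) (d : ℕ) :
    A d = B d := by
  have hfin : ∀ x : ℝ, 2 * x < 1 → ∑' d, ENNReal.ofReal x ^ d * B d ≠ ∞ := by
    intro x hx
    have h1 : ENNReal.ofReal x < 1 := by
      rw [← ENNReal.ofReal_one, ENNReal.ofReal_lt_ofReal_iff one_pos]
      linarith
    refine ne_top_of_le_ne_top (ENNReal.mul_ne_top hC (tsum_pow_mul_succ_ne_top h1)) ?_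
    rw [← ENNReal.tsum_mul_left]
    refine ENNReal.tsum_le_tsum fun d => ?_
    calc _ ≤ ENNReal.ofReal x ^ d * (C * (d + 1)) := mul_le_mul_right (hB d) _
      _ = _ := by ring
  have hBfin : ∀ d, B d ≠ ∞ := fun d => ne_top_of_le_ne_top
    (ENNReal.mul_ne_top hC (ENNReal.add_ne_top.2 ⟨ENNReal.natCast_ne_top d, ENNReal.one_ne_top⟩))
    (hB d)
  -- No bound on `A` is needed: an infinite coefficient would make the series infinite at `x = 1/4`,
  -- where the `B` side is finite.
  have hAfin : ∀ d, A d ≠ ∞ := by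
    intro d hd
    have h1 := h (1 / 4) (by norm_num) (by norm_num)
    refine hfin (1 / 4) (by norm_num) (top_le_iff.1 ?_)
    rw [← h1]
    refine le_trans ?_ (ENNReal.le_tsum d)
    rw [hd, ENNReal.mul_top]
    exact pow_ne_zero _ (by simp)
  have hsum : ∀ (D : ℕ → ℝ≥0∞) (x : ℝ), 0 < x → ∑' d, ENNReal.ofReal x ^ d * D d ≠ ∞ →
      HasSum (fun d => (D d).toReal * x ^ d) (∑' d, ENNReal.ofReal x ^ d * D d).toReal := by
    intro D x hx hD
    have h1 := ENNReal.hasSum_toReal hD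
    rw [← ENNReal.tsum_toReal_eq (ENNReal.ne_top_of_tsum_ne_top hD)] at h1
    simpa only [ENNReal.toReal_mul, ENNReal.toReal_pow, ENNReal.toReal_ofReal hx.le, mul_comm]
      using h1
  have key := eq_zero_of_hasSum_pow (c := fun d => (A d).toReal - (B d).toReal) (r := 1 / 4)
    (by norm_num) (fun x hx0 hx => by
      have h1 := hfin x (by linarith)
      have h2 := hsum B x hx0 h1
      have h3 := hsum A x hx0 (by rwa [h x hx0 (by linarith)])
      rw [h x hx0 (by linarith)] at h3
      simpa [sub_mul] using h3.sub h2) d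
  exact (ENNReal.toReal_eq_toReal_iff' (hAfin d) (hBfin d)).1 (sub_eq_zero.1 key)

/-! ### The weights, the sum formula and the weighted sum formula -/

/-- The coefficient `C(t_1, …, t_r)` in terms of the exponents `e_i = t_i - 1`; the last entry
of `e` does not contribute. -/
noncomputable def ecoeff : (r : ℕ) → (Fin (r + 1) → ℕ) → ℝ≥0∞
  | 0, _ => 1
  | r + 1, e => 2 ^ e 0 * (1 + ecoeff r (Fin.tail e))

/-- The weight in terms of the exponents `e_i = s_i - 1`, restricted to `e_1 ≥ 1`. -/
noncomputable def eweight (j : ℕ) (e : Fin (j + 2) → ℕ) : ℝ≥0∞ :=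
  (2 ^ e 0 - 1) * ecoeff j (Fin.tail e) + if e 0 = 0 then 0 else 2 ^ e 0

/-- The sum over all exponents of total degree `d`, weighted by `Ψ`. -/
noncomputable def weightedSum {k : ℕ} (Ψ : (Fin (k + 1) → ℕ) → ℝ≥0∞) (d : ℕ) : ℝ≥0∞ :=
  ∑ e ∈ Nat.antidiagonalTuple (k + 1) d, Ψ e * emzv (fun i => e i + 1)

/-- The zeta value as an extended nonnegative real. -/
noncomputable def ezeta (n : ℕ) : ℝ≥0∞ := ∑' m, pole 0 m ^ n

theorem mzvGF_eq_tsum (X : ℝ≥0∞) {k : ℕ} (Ψ : (Fin (k + 1) → ℕ) → ℝ≥0∞) :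
    mzvGF X Ψ = ∑' d, X ^ d * weightedSum Ψ d := by
  rw [mzvGF, ← (Nat.sigmaAntidiagonalTupleEquivTuple (k + 1)).tsum_eq, ENNReal.tsum_sigma']
  refine tsum_congr fun d => ?_
  rw [tsum_fintype, weightedSum, mul_sum, ← sum_coe_sort (Nat.antidiagonalTuple (k + 1) d)]
  refine sum_congr rfl fun e _ => ?_
  have := Nat.mem_antidiagonalTuple.1 e.2
  simp only [Nat.sigmaAntidiagonalTupleEquivTuple, Equiv.coe_fn_mk, this]
  ring

theorem ezeta_le {n : ℕ} (hn : 2 ≤ n) : ezeta n ≤ ezeta 2 := by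
  refine ENNReal.tsum_le_tsum fun m => pow_le_pow_right_of_le_one' ?_ hn
  rw [pole, ← ENNReal.ofReal_one]
  refine ENNReal.ofReal_le_ofReal ?_
  rw [div_le_one (factor_pos zero_lt_one m)]
  have : (0 : ℝ) ≤ m := m.cast_nonneg
  linarith

theorem pole_zero_pow_eq (n m : ℕ) :
    pole 0 m ^ n = ENNReal.ofReal (1 / ((m + 1 : ℕ) : ℝ) ^ n) := by
  rw [pole, ← ENNReal.ofReal_pow (one_div_pos.2 (factor_pos zero_lt_one m)).le]
  congr 1
  push_cast
  rw [sub_zero, div_pow, one_pow]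

theorem ezeta_eq_ofReal {n : ℕ} (hn : 2 ≤ n) :
    ezeta n = ENNReal.ofReal (∑' m : ℕ, 1 / ((m + 1 : ℕ) : ℝ) ^ n) := by
  have hs : Summable fun m : ℕ => 1 / ((m + 1 : ℕ) : ℝ) ^ n :=
    (summable_nat_add_iff 1).2 (Real.summable_one_div_nat_pow.2 hn)
  rw [ENNReal.ofReal_tsum_of_nonneg (fun m => by positivity) hs]
  exact tsum_congr fun m => pole_zero_pow_eq n m

theorem ezeta_ne_top {n : ℕ} (hn : 2 ≤ n) : ezeta n ≠ ∞ := by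
  rw [ezeta_eq_ofReal hn]
  exact ENNReal.ofReal_ne_top

theorem ofReal_toReal_ezeta {n : ℕ} (hn : 2 ≤ n) : ((ezeta n).toReal : ℂ) = riemannZeta n := by
  rw [ezeta_eq_ofReal hn, ENNReal.toReal_ofReal (tsum_nonneg fun m => by positivity),
    zeta_nat_eq_tsum_of_gt_one (by omega)]
  have hs := Real.summable_one_div_nat_pow.2 (show 1 < n by omega)
  have h := hs.tsum_eq_zero_add
  rw [Nat.cast_zero, zero_pow (by omega), div_zero, zero_add] at h
  rw [← h]
  push_cast
  rfl

theorem truncGF_one {x : ℝ} (hx0 : 0 ≤ x) (hx : x < 1) (k N : ℕ) :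
    truncGF (ENNReal.ofReal x) (fun _ : Fin k → ℕ => 1) N = elem (pole x) k N := by
  induction k generalizing N with
  | zero => simp [truncGF, elem, harmonicSum, tsum_fintype]
  | succ k ih =>
    rw [truncGF_cons (φ := fun _ => 1) (Φ := fun _ => 1) (fun _ _ => (one_mul 1).symm), elem]
    simp_rw [ih, poleGF_one hx0 hx]

/-- The recursion `2 ^ e 0 * (1 + ⋯)` of `ecoeff` is `shuffleSum_succ` with `b = pole (2 * x)`. -/
theorem truncGF_ecoeff {x : ℝ} (hx0 : 0 ≤ x) (hx : 2 * x < 1) (j N : ℕ) :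
    truncGF (ENNReal.ofReal x) (ecoeff j) N = shuffleSum (pole x) j N := by
  have hx1 : x < 1 := by linarith
  induction j generalizing N with
  | zero =>
    have h : ecoeff 0 = fun _ => 1 := rfl
    rw [h, truncGF_one hx0 hx1]
    simp only [elem, shuffleSum, mul_one]
    exact (sum_range_reflect _ _).symm
  | succ j ih =>
    rw [truncGF_cons (φ := fun a => 2 ^ a) (Φ := fun e => 1 + ecoeff j e)
      (fun a e => by simp [ecoeff]), shuffleSum_succ (pole_two_mul hx)]
    refine sum_congr rfl fun M _ => ?_
    rw [truncGF_add, ih, truncGF_one hx0 hx1, poleGF_two_pow hx0 hx]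

/-- Weighting by total degree is `x d/dx`, which by Leibniz replaces one pole at a time by `x` times
its square. -/
theorem truncGF_sum {x : ℝ} (hx0 : 0 ≤ x) (hx : x < 1) (k N : ℕ) :
    truncGF (ENNReal.ofReal x) (fun e : Fin k → ℕ => ((∑ i, e i : ℕ) : ℝ≥0∞)) N
      = derivSum (pole x) (fun q => ENNReal.ofReal x * (pole x q * pole x q)) k N := by
  induction k generalizing N with
  | zero => simp [truncGF, derivSum]
  | succ k ih =>
    have h : (fun e : Fin (k + 1) → ℕ => ((∑ i, e i : ℕ) : ℝ≥0∞))
        = fun e => (e 0 : ℝ≥0∞) + ((∑ i, Fin.tail e i : ℕ) : ℝ≥0∞) := by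
      funext e
      rw [Fin.sum_univ_succ, Nat.cast_add]
      rfl
    rw [h, truncGF_add, truncGF_cons (φ := fun a => (a : ℝ≥0∞)) (Φ := fun _ => 1) (by simp),
      truncGF_cons (φ := fun _ => 1) (Φ := fun e => ((∑ i, e i : ℕ) : ℝ≥0∞)) (by simp),
      derivSum, ← sum_add_distrib]
    refine sum_congr rfl fun m _ => ?_
    rw [ih, truncGF_one hx0 hx, poleGF_one hx0 hx, poleGF_natCast hx0 hx]

theorem mzvGF_eweight {x : ℝ} (hx0 : 0 ≤ x) (hx : 2 * x < 1) (j : ℕ) :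
    mzvGF (ENNReal.ofReal x) (eweight j)
      = ∑' M, poleSub (2 * x) x M * shuffleSum (pole x) j M
        + ∑' M, poleSub (2 * x) 0 M * elem (pole x) (j + 1) M := by
  have hx1 : x < 1 := by linarith
  have h : eweight j = fun e => (2 ^ e 0 - 1) * ecoeff j (Fin.tail e)
    + if e 0 = 0 then 0 else 2 ^ e 0 := rfl
  rw [h, mzvGF_add, mzvGF_cons (φ := fun a => 2 ^ a - 1) (Φ := ecoeff j) (by simp),
    mzvGF_cons (φ := fun a => if a = 0 then 0 else 2 ^ a) (Φ := fun _ => 1) (by simp)]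
  congr 1
  · exact tsum_congr fun M => by
      rw [truncGF_ecoeff hx0 hx, poleGF_two_pow_sub_one hx0 hx]
  · exact tsum_congr fun M => by
      rw [truncGF_one hx0 hx1, poleGF_ite (pow_zero 2) (by positivity) hx
        (poleGF_two_pow hx0 hx M)]

theorem mzvGF_ite {x : ℝ} (hx0 : 0 ≤ x) (hx : x < 1) (j : ℕ) :
    mzvGF (ENNReal.ofReal x) (fun e : Fin (j + 1) → ℕ => if e 0 = 0 then 0 else 1)
      = ∑' M, poleSub x 0 M * elem (pole x) j M := by
  rw [mzvGF_cons (φ := fun a => if a = 0 then 0 else 1) (Φ := fun _ => 1) (by simp)]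
  exact tsum_congr fun M => by
    rw [truncGF_one hx0 hx, poleGF_ite rfl hx0 hx (poleGF_one hx0 hx M)]

theorem mzvGF_pred {x : ℝ} (hx0 : 0 ≤ x) (hx : x < 1) (j : ℕ) :
    mzvGF (ENNReal.ofReal x)
        (fun e : Fin (j + 1) → ℕ => if e 0 = 0 then 0 else ((∑ i, e i - 1 : ℕ) : ℝ≥0∞))
      = ENNReal.ofReal x * ∑' q, pole 0 q
        * (ENNReal.ofReal x * (pole x q * pole x q) * elem (pole x) j q
          + pole x q * derivSum (pole x)
            (fun q => ENNReal.ofReal x * (pole x q * pole x q)) j q) := by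
  -- The `-1` is charged to the first entry; truncated subtraction makes `e 0 - 1` vanish at `e 0 =
  -- 0`, so this summand needs no indicator.
  have h : (fun e : Fin (j + 1) → ℕ => if e 0 = 0 then 0 else ((∑ i, e i - 1 : ℕ) : ℝ≥0∞))
      = fun e => ((e 0 - 1 : ℕ) : ℝ≥0∞)
        + (if e 0 = 0 then 0 else 1) * ((∑ i, Fin.tail e i : ℕ) : ℝ≥0∞) := by
    funext e
    split_ifs with h0
    · simp [h0]
    · rw [one_mul, ← Nat.cast_add, Fin.sum_univ_succ, Nat.sub_add_comm (Nat.pos_of_ne_zero h0)]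
      rfl
  rw [h, mzvGF_add, mzvGF_cons (φ := fun a => ((a - 1 : ℕ) : ℝ≥0∞)) (Φ := fun _ => 1) (by simp),
    mzvGF_cons (φ := fun a => if a = 0 then 0 else 1)
      (Φ := fun e => ((∑ i, e i : ℕ) : ℝ≥0∞)) (by simp),
    ← ENNReal.tsum_add, ← ENNReal.tsum_mul_left]
  refine tsum_congr fun q => ?_
  rw [truncGF_one hx0 hx, truncGF_sum hx0 hx, poleGF_pred hx0 hx,
    poleGF_ite rfl hx0 hx (poleGF_one hx0 hx q), poleSub_zero hx0 hx]
  ring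

theorem mzvGF_ite_eq_ezeta {x : ℝ} (hx0 : 0 ≤ x) (hx : x < 1) (j : ℕ) :
    mzvGF (ENNReal.ofReal x) (fun e : Fin (j + 1) → ℕ => if e 0 = 0 then 0 else 1)
      = ∑' d, ENNReal.ofReal x ^ d * (if d = 0 then 0 else ezeta (d + j + 1)) := by
  have h1 : ∀ M, poleSub x 0 M * elem (pole x) j M
      = ENNReal.ofReal x * (pole 0 M * pole x M * elem (pole x) j M) := by
    intro M
    rw [poleSub_zero hx0 hx]
    ring
  rw [mzvGF_ite hx0 hx]
  simp_rw [h1]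
  rw [ENNReal.tsum_mul_left, ← tsum_pole_mul_pow hx,
    tsum_eq_zero_add' (f := fun d => ENNReal.ofReal x ^ d * _) ENNReal.summable]
  simp only [if_true, mul_zero, zero_add, Nat.add_eq_zero_iff, one_ne_zero, and_false, if_false,
    ezeta, ← ENNReal.tsum_mul_left]
  rw [ENNReal.tsum_comm]
  refine tsum_congr fun m => ?_
  rw [← poleGF_one hx0 hx, poleGF, ← ENNReal.tsum_mul_right, ← ENNReal.tsum_mul_left]
  refine tsum_congr fun d => ?_
  have e : d + 1 + j + 1 = (d + 1) + (j + 1) := by ring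
  rw [e, pow_add _ (d + 1) (j + 1)]
  ring

/-- The sum formula for multiple zeta values. -/
theorem weightedSum_ite (j d : ℕ) :
    weightedSum (fun e : Fin (j + 1) → ℕ => if e 0 = 0 then 0 else 1) d
      = if d = 0 then 0 else ezeta (d + j + 1) := by
  refine eq_of_tsum_pow_mul_eq (C := ezeta 2)
    (B := fun d => if d = 0 then 0 else ezeta (d + j + 1)) (ezeta_ne_top le_rfl) ?_ ?_ d
  · intro d
    split_ifs with hd
    · exact zero_le
    · refine (ezeta_le (by omega)).trans ?_
      exact le_mul_of_one_le_right (zero_le) le_add_self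
  · intro x hx0 hx
    rw [← mzvGF_eq_tsum, mzvGF_ite_eq_ezeta hx0.le (by linarith)]

theorem weightedSum_pred (j d : ℕ) :
    weightedSum
        (fun e : Fin (j + 1) → ℕ => if e 0 = 0 then 0 else ((∑ i, e i - 1 : ℕ) : ℝ≥0∞)) d
      = ((d - 1 : ℕ) : ℝ≥0∞) * if d = 0 then 0 else ezeta (d + j + 1) := by
  rw [← weightedSum_ite, weightedSum, weightedSum, mul_sum]
  refine sum_congr rfl fun e he => ?_
  rw [Nat.mem_antidiagonalTuple.1 he]
  split_ifs <;> ring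

/-- The weighted sum formula for multiple zeta values. -/
theorem weightedSum_eweight (j d : ℕ) :
    weightedSum (eweight j) d
      = if d = 0 then 0 else ((d + j + 2 : ℕ) : ℝ≥0∞) * ezeta (d + j + 2) := by
  refine eq_of_tsum_pow_mul_eq (C := ezeta 2 * (j + 2))
    (B := fun d => if d = 0 then 0 else ((d + j + 2 : ℕ) : ℝ≥0∞) * ezeta (d + j + 2))
    (ENNReal.mul_ne_top (ezeta_ne_top le_rfl) (by exact_mod_cast ENNReal.natCast_ne_top (j + 2)))
    ?_ ?_ d
  · intro d
    split_ifs with hd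
    · exact zero_le
    · rw [mul_comm, mul_assoc]
      refine mul_le_mul' (ezeta_le (by omega)) ?_
      have : d + j + 2 ≤ (j + 2) * (d + 1) := by nlinarith
      exact_mod_cast this
  · intro x hx0 hx
    have hx1 : x < 1 := by linarith
    have hX : ENNReal.ofReal x ≠ 0 := by simpa using hx0
    -- The sum formula in depth `j + 1`, weighted by degree minus one; cancelling a factor `x`
    -- shifts the degree to `d` and yields the contribution `n - k = d`.
    have h1 : ∑' d : ℕ, ENNReal.ofReal x ^ d * ((d : ℝ≥0∞) * ezeta (d + j + 2))
        = ∑' q, pole 0 q * (ENNReal.ofReal x * (pole x q * pole x q) * elem (pole x) j q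
          + pole x q * derivSum (pole x)
            (fun q => ENNReal.ofReal x * (pole x q * pole x q)) j q) := by
      rw [← ENNReal.mul_right_inj hX ENNReal.ofReal_ne_top, ← mzvGF_pred hx0.le hx1,
        mzvGF_eq_tsum, tsum_eq_zero_add' (f := fun d => ENNReal.ofReal x ^ d * weightedSum _ d)
        ENNReal.summable, ← ENNReal.tsum_mul_left]
      simp only [weightedSum_pred, if_true, mul_zero, zero_add, Nat.add_eq_zero_iff, one_ne_zero,
        and_false, if_false, add_tsub_cancel_right]
      refine tsum_congr fun d => ?_
      rw [show d + 1 + j + 1 = d + j + 2 by ring]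
      ring
    rw [← mzvGF_eq_tsum, mzvGF_eweight hx0.le hx, tsum_shuffle_eq hx0.le hx j (fun _ => rfl),
      ← h1, ← mzvGF_ite hx0.le hx1, mzvGF_ite_eq_ezeta hx0.le hx1, ← ENNReal.tsum_mul_left,
      ← ENNReal.tsum_add]
    refine tsum_congr fun d => ?_
    split_ifs with hd
    · simp [hd]
    · rw [← add_assoc d j 1]
      push_cast
      ring

/-! ### From nested extended sums to the real series -/

theorem strictAnti_cons_iff {k : ℕ} (a : ℕ) (m : Fin k → ℕ) :
    StrictAnti (Fin.cons a m : Fin (k + 1) → ℕ) ↔ StrictAnti m ∧ ∀ i, m i < a := by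
  constructor
  · intro h
    refine ⟨fun i j hij => ?_, fun i => ?_⟩
    · simpa using h (Fin.succ_lt_succ_iff.2 hij)
    · simpa using h (Fin.succ_pos i)
  · rintro ⟨h1, h2⟩ i j hij
    cases j using Fin.cases with
    | zero => exact absurd hij (Fin.not_lt_zero i)
    | succ j =>
      cases i using Fin.cases with
      | zero => simpa using h2 j
      | succ i => simpa using h1 (Fin.succ_lt_succ_iff.1 hij)

open Classical in
theorem harmonicSum_eq_tsum {k : ℕ} (s : Fin k → ℕ) (N : ℕ) :
    harmonicSum k s N = ∑' m : Fin k → ℕ,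
      if StrictAnti m ∧ ∀ i, m i < N then ∏ i, pole 0 (m i) ^ s i else 0 := by
  induction k generalizing N with
  | zero =>
    rw [tsum_fintype, Fintype.sum_unique, if_pos ⟨Subsingleton.strictAnti _, fun i => i.elim0⟩]
    simp [harmonicSum]
  | succ k ih =>
    rw [tsum_fin_succ, tsum_eq_sum (s := range N), harmonicSum]
    · refine sum_congr rfl fun a ha => ?_
      rw [ih, ← ENNReal.tsum_mul_left]
      refine tsum_congr fun m => ?_
      have ha' := mem_range.1 ha
      have e : (StrictAnti (Fin.cons a m : Fin (k + 1) → ℕ)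
          ∧ ∀ i, (Fin.cons a m : Fin (k + 1) → ℕ) i < N) ↔ StrictAnti m ∧ ∀ i, m i < a := by
        rw [strictAnti_cons_iff, Fin.forall_fin_succ]
        simp only [Fin.cons_zero, Fin.cons_succ]
        exact ⟨fun h => h.1, fun h => ⟨h, ha', fun i => (h.2 i).trans ha'⟩⟩
      rw [if_congr e rfl rfl, Fin.prod_univ_succ]
      simp only [Fin.cons_zero, Fin.cons_succ, mul_ite, mul_zero]
      rfl
    · intro a ha
      refine ENNReal.tsum_eq_zero.2 fun m => if_neg fun h => ha ?_
      simpa using h.2 0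

open Classical in
theorem emzv_eq_tsum {k : ℕ} (s : Fin (k + 1) → ℕ) :
    emzv s = ∑' m : Fin (k + 1) → ℕ, if StrictAnti m then ∏ i, pole 0 (m i) ^ s i else 0 := by
  rw [tsum_fin_succ, emzv]
  refine tsum_congr fun a => ?_
  rw [harmonicSum_eq_tsum, ← ENNReal.tsum_mul_left]
  refine tsum_congr fun m => ?_
  rw [if_congr (strictAnti_cons_iff a m) rfl rfl, Fin.prod_univ_succ]
  simp only [Fin.cons_zero, Fin.cons_succ, mul_ite, mul_zero]
  rfl

/-- Strictly decreasing tuples of natural numbers, shifted by one. -/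
def indexEquiv (k : ℕ) : {m : Fin k → ℕ | StrictAnti m} ≃ Index k where
  toFun m := ⟨fun i => m.1 i + 1, fun _ _ h => Nat.succ_lt_succ (m.2 h), fun _ => Nat.succ_pos _⟩
  invFun m := ⟨fun i => m.1 i - 1, fun i j h => by
    have := m.2.1 h
    have := m.2.2 j
    change m.1 j - 1 < m.1 i - 1
    omega⟩
  left_inv m := by ext i; simp
  right_inv m := Subtype.ext (funext fun i => Nat.sub_add_cancel (m.2.2 i))

theorem emzv_eq_tsum_term {k : ℕ} (s : Fin (k + 1) → ℕ) :
    emzv s = ∑' m : Index (k + 1), ENNReal.ofReal (term s m) := by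
  classical
  rw [emzv_eq_tsum, ← (indexEquiv (k + 1)).tsum_eq]
  have h : ∀ m : {m : Fin (k + 1) → ℕ | StrictAnti m},
      ENNReal.ofReal (term s (indexEquiv (k + 1) m)) = ∏ i, pole 0 (m.1 i) ^ s i := by
    intro m
    simp_rw [pole_zero_pow_eq]
    rw [← ENNReal.ofReal_prod_of_nonneg fun i _ => by positivity, prod_div_distrib, prod_const_one]
    rfl
  simp_rw [h]
  rw [tsum_subtype {m : Fin (k + 1) → ℕ | StrictAnti m} fun m => ∏ i, pole 0 (m i) ^ s i]
  simp only [Set.indicator_apply, Set.mem_ofPred_eq]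

theorem term_nonneg {k : ℕ} (s : Fin k → ℕ) (m : Index k) : 0 ≤ term s m := by
  rw [term]
  positivity

theorem summable_term {k : ℕ} {s : Fin (k + 1) → ℕ} (h : emzv s ≠ ∞) : Summable (term s) := by
  rw [emzv_eq_tsum_term] at h
  refine (ENNReal.summable_toReal h).congr fun m => ?_
  rw [ENNReal.toReal_ofReal (term_nonneg s m)]

theorem mzv_eq_toReal {k : ℕ} (s : Fin (k + 1) → ℕ) : mzv s = (emzv s).toReal := by
  rw [emzv_eq_tsum_term, ENNReal.tsum_toReal_eq fun m => ENNReal.ofReal_ne_top]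
  exact tsum_congr fun m => (ENNReal.toReal_ofReal (term_nonneg s m)).symm

theorem mem_admissible_succ {k n : ℕ} {s : Fin (k + 1) → ℕ} :
    s ∈ admissible (k + 1) n ↔ ∑ i, s i = n ∧ (∀ i, 1 ≤ s i) ∧ 2 ≤ s 0 := by
  rw [admissible, mem_filter, Nat.mem_antidiagonalTuple]
  refine and_congr_right fun _ => and_congr_right fun _ => ⟨fun h => h 0 rfl, fun h i hi => ?_⟩
  rwa [show i = 0 from Fin.ext hi]

/-- A weighted sum over admissible tuples in terms of the exponents `s_i - 1`. -/
theorem sum_admissible_eq_weightedSum {k d : ℕ} {Ψ : (Fin (k + 1) → ℕ) → ℝ≥0∞}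
    (hΨ : ∀ e, e 0 = 0 → Ψ e = 0) :
    ∑ s ∈ admissible (k + 1) (d + (k + 1)), Ψ (fun i => s i - 1) * emzv s = weightedSum Ψ d := by
  -- Tuples with `e 0 = 0` have no admissible preimage, but their weight vanishes.
  refine sum_bij_ne_zero (fun s _ _ i => s i - 1) ?_ ?_ ?_ ?_
  · intro s hs _
    obtain ⟨h1, h2, _⟩ := mem_admissible_succ.1 hs
    rw [Nat.mem_antidiagonalTuple]
    have h3 : ∑ i, s i = ∑ i, (s i - 1) + (k + 1) := by
      rw [← sum_congr rfl fun i _ => Nat.sub_add_cancel (h2 i), sum_add_distrib]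
      simp
    omega
  · intro s hs _ t ht _ h
    funext i
    have h1 := congr_fun h i
    have h2 := (mem_admissible_succ.1 hs).2.1 i
    have h3 := (mem_admissible_succ.1 ht).2.1 i
    change s i - 1 = t i - 1 at h1
    omega
  · intro e he hne
    refine ⟨fun i => e i + 1, ?_, ?_, ?_⟩
    · rw [mem_admissible_succ, sum_add_distrib, Nat.mem_antidiagonalTuple.1 he]
      refine ⟨by simp, fun i => by omega, ?_⟩
      by_contra h0
      exact hne (by rw [hΨ e (by omega), zero_mul])
    · simpa using hne
    · simp
  · intro s hs _
    have h2 := (mem_admissible_succ.1 hs).2.1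
    have h3 : (fun i => s i - 1 + 1) = s := funext fun i => Nat.sub_add_cancel (h2 i)
    change _ = Ψ (fun i => s i - 1) * emzv fun i => s i - 1 + 1
    rw [h3]

/-! ### The real weights and their recursion -/

theorem partialSum_zero {k : ℕ} (s : Fin k → ℕ) : partialSum s 0 = 0 := by
  simp [partialSum]

theorem partialSum_succ {k : ℕ} (s : Fin (k + 1) → ℕ) (i : ℕ) :
    partialSum s (i + 1) = s 0 + partialSum (Fin.tail s) i := by
  simp only [partialSum, sum_filter]
  rw [Fin.sum_univ_succ]
  simp [Fin.tail]

theorem partialSum_castSucc {k : ℕ} (s : Fin (k + 1) → ℕ) {i : ℕ} (hi : i ≤ k) :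
    partialSum (fun j : Fin k => s j.castSucc) i = partialSum s i := by
  simp only [partialSum, sum_filter]
  rw [Fin.sum_univ_castSucc]
  simp [hi.not_gt]

theorem coeffC_zero (t : Fin 0 → ℕ) : coeffC t = 1 := by
  simp [coeffC, partialSum]

/-- Every exponent contains `t_1 - 1`; once it is factored out, the `j = 1` term leaves the `1`.
This recursion matches `ecoeff` and makes the two forms of the weight agree. -/
theorem coeffC_succ {r : ℕ} (t : Fin (r + 1) → ℕ) :
    coeffC t = 2 ^ ((t 0 : ℤ) - 1) * (1 + coeffC (Fin.tail t)) := by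
  have h : ∀ i : ℕ, (2 : ℝ) ^ (partialSum t (i + 1) - ((i + 1 : ℕ) : ℤ))
      = 2 ^ ((t 0 : ℤ) - 1) * 2 ^ (partialSum (Fin.tail t) i - (i : ℤ)) := by
    intro i
    rw [partialSum_succ, ← zpow_add₀ two_ne_zero]
    congr 1
    push_cast
    ring
  rw [coeffC, coeffC, ← Ico_add_one_right_eq_Icc, ← Ico_add_one_right_eq_Icc,
    sum_Ico_eq_sum_range, sum_Ico_eq_sum_range]
  simp only [add_tsub_cancel_right, add_comm 1]
  rw [sum_range_succ']
  simp only [h]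
  rw [← mul_sum, partialSum_zero]
  simp only [Nat.cast_zero, sub_zero, zpow_zero]
  ring

theorem weight_eq {r : ℕ} (hk : 2 ≤ r + 2) (s : Fin (r + 2) → ℕ) :
    weight hk s = 2 ^ ((s 0 : ℤ) - 1)
      + (2 ^ ((s 0 : ℤ) - 1) - 1) * coeffC fun i : Fin r => Fin.tail s i.castSucc := by
  have h : ∀ i ≤ r, partialSum s (i + 1) - (s 0 : ℤ)
      = partialSum (fun i : Fin r => Fin.tail s i.castSucc) i := by
    intro i hi
    rw [partialSum_castSucc _ hi, partialSum_succ]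
    ring
  have h1 : ∑ i ∈ Icc 2 (r + 1), (2 : ℝ) ^ (partialSum s i - (s 0 : ℤ) - ((i : ℤ) - 1))
      = ∑ j ∈ Icc 1 r,
        (2 : ℝ) ^ (partialSum (fun i : Fin r => Fin.tail s i.castSucc) j - (j : ℤ)) := by
    rw [← Ico_add_one_right_eq_Icc, ← Ico_add_one_right_eq_Icc, sum_Ico_eq_sum_range,
      sum_Ico_eq_sum_range]
    refine sum_congr rfl fun i hi => ?_
    have hi' := mem_range.1 hi
    rw [show 2 + i = 1 + i + 1 by ring, h (1 + i) (by omega)]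
    push_cast
    ring_nf
  have h2 : partialSum s (r + 1) - (s 0 : ℤ) - (((r + 2 : ℕ) : ℤ) - 2)
      = partialSum (fun i : Fin r => Fin.tail s i.castSucc) r - (r : ℤ) := by
    rw [h r le_rfl]
    push_cast
    ring
  rw [coeffC, ← h1, ← h2]
  rfl

theorem weightC_eq {r : ℕ} (hk : 2 ≤ r + 2) (s : Fin (r + 2) → ℕ) :
    weightC hk s = 2 ^ ((s 0 : ℤ) - 1)
      + (2 ^ ((s 0 : ℤ) - 1) - 1) * coeffC fun i : Fin r => Fin.tail s i.castSucc := by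
  have h : weightC hk s = coeffC (fun i : Fin (r + 1) => s ⟨i, by omega⟩)
    - coeffC fun i : Fin r => Fin.tail s i.castSucc := rfl
  have h2 : Fin.tail (fun i : Fin (r + 1) => s ⟨i, by omega⟩)
    = fun i : Fin r => Fin.tail s i.castSucc := rfl
  rw [h, coeffC_succ, h2]
  have h3 : s ⟨(0 : Fin (r + 1)), by omega⟩ = s 0 := rfl
  rw [h3]
  ring

theorem coeffC_nonneg {r : ℕ} (t : Fin r → ℕ) : 0 ≤ coeffC t := by
  rw [coeffC]
  positivity

theorem two_zpow_sub_one {a : ℕ} (ha : 1 ≤ a) : (2 : ℝ) ^ ((a : ℤ) - 1) = 2 ^ (a - 1) := by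
  rw [← zpow_natCast]
  congr 1
  omega

theorem ofReal_coeffC {r : ℕ} {t : Fin (r + 1) → ℕ} (ht : ∀ i, 1 ≤ t i) :
    ENNReal.ofReal (coeffC fun i : Fin r => t i.castSucc) = ecoeff r fun i => t i - 1 := by
  induction r with
  | zero => simp [coeffC_zero, ecoeff]
  | succ r ih =>
    have h : Fin.tail (fun i : Fin (r + 1) => t i.castSucc)
      = fun i : Fin r => Fin.tail t i.castSucc := rfl
    have h2 := ih (t := Fin.tail t) fun i => ht _
    rw [coeffC_succ, h, ecoeff, ENNReal.ofReal_mul (by positivity),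
      ENNReal.ofReal_add zero_le_one (coeffC_nonneg _), h2, two_zpow_sub_one (ht _),
      ENNReal.ofReal_pow zero_le_two]
    simp
    rfl

theorem ofReal_weight {r : ℕ} (hk : 2 ≤ r + 2) {s : Fin (r + 2) → ℕ} (hs : ∀ i, 1 ≤ s i)
    (hs0 : 2 ≤ s 0) : ENNReal.ofReal (weight hk s) = eweight r fun i => s i - 1 := by
  have h := ofReal_coeffC (t := Fin.tail s) fun i => hs _
  have h1 : (0 : ℝ) ≤ 2 ^ (s 0 - 1) - 1 := sub_nonneg.2 (one_le_pow₀ one_le_two)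
  rw [weight_eq, two_zpow_sub_one (hs 0), ENNReal.ofReal_add (by positivity)
    (mul_nonneg h1 (coeffC_nonneg _)), ENNReal.ofReal_mul h1, h, eweight,
    if_neg (show ¬s 0 - 1 = 0 by omega), add_comm, ENNReal.ofReal_sub _ zero_le_one,
    ENNReal.ofReal_pow zero_le_two]
  simp
  rfl

theorem weight_nonneg {r : ℕ} (hk : 2 ≤ r + 2) {s : Fin (r + 2) → ℕ} (hs0 : 1 ≤ s 0) :
    0 ≤ weight hk s := by
  rw [weight_eq, two_zpow_sub_one hs0]
  have h1 : (0 : ℝ) ≤ 2 ^ (s 0 - 1) - 1 := sub_nonneg.2 (one_le_pow₀ one_le_two)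
  have := coeffC_nonneg fun i : Fin r => Fin.tail s i.castSucc
  positivity

/-! ### Finiteness and the real-valued sum formulas -/

theorem sum_admissible_emzv (k d : ℕ) :
    ∑ s ∈ admissible (k + 1) (d + 1 + (k + 1)), emzv s = ezeta (d + 1 + (k + 1)) := by
  have h := sum_admissible_eq_weightedSum (k := k) (d := d + 1)
    (Ψ := fun e => if e 0 = 0 then 0 else 1) fun e he => if_pos he
  rw [weightedSum_ite, if_neg d.succ_ne_zero, add_assoc (d + 1)] at h
  rw [← h]
  refine sum_congr rfl fun s hs => ?_
  have := (mem_admissible_succ.1 hs).2.2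
  rw [if_neg (show ¬s 0 - 1 = 0 by omega), one_mul]

/-- Convergence comes from the sum formula itself: each term is at most the total, `ζ(n)`. -/
theorem emzv_ne_top {k n : ℕ} (hn : k + 2 ≤ n) {s : Fin (k + 1) → ℕ}
    (hs : s ∈ admissible (k + 1) n) : emzv s ≠ ∞ := by
  obtain ⟨d, rfl⟩ : ∃ d, n = d + 1 + (k + 1) := ⟨n - (k + 2), by omega⟩
  refine ne_top_of_le_ne_top (ezeta_ne_top (n := d + 1 + (k + 1)) (by omega)) ?_
  rw [← sum_admissible_emzv]
  exact single_le_sum (f := emzv) (fun _ _ => zero_le) hs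

theorem sum_admissible_mzv {k n : ℕ} (hn : k + 2 ≤ n) :
    ∑ s ∈ admissible (k + 1) n, mzv s = (ezeta n).toReal := by
  obtain ⟨d, rfl⟩ : ∃ d, n = d + 1 + (k + 1) := ⟨n - (k + 2), by omega⟩
  rw [← sum_admissible_emzv, ENNReal.toReal_sum fun s hs => emzv_ne_top hn hs]
  exact sum_congr rfl fun s _ => mzv_eq_toReal s

theorem sum_admissible_weight_mul_mzv {r n : ℕ} (hk : 2 ≤ r + 2) (hn : r + 3 ≤ n) :
    ∑ s ∈ admissible (r + 2) n, weight hk s * mzv s = n * (ezeta n).toReal := by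
  have hfin := fun s hs => emzv_ne_top (k := r + 1) (n := n) (s := s) hn hs
  obtain ⟨d, rfl⟩ : ∃ d, n = d + 1 + (r + 1 + 1) := ⟨n - (r + 3), by omega⟩
  have h := sum_admissible_eq_weightedSum (k := r + 1) (d := d + 1)
    (Ψ := eweight r) fun e he => by simp [eweight, he]
  rw [weightedSum_eweight, if_neg d.succ_ne_zero] at h
  have h2 := congr_arg ENNReal.toReal h
  rw [ENNReal.toReal_mul, ENNReal.toReal_natCast] at h2
  refine Eq.trans ?_ h2
  have h3 : ∀ s ∈ admissible (r + 2) (d + 1 + (r + 1 + 1)),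
      eweight r (fun i => s i - 1) = ENNReal.ofReal (weight hk s) := by
    intro s hs
    have h4 := mem_admissible_succ.1 hs
    rw [ofReal_weight hk h4.2.1 h4.2.2]
  rw [ENNReal.toReal_sum]
  · refine sum_congr rfl fun s hs => ?_
    have h4 := mem_admissible_succ.1 hs
    rw [h3 s hs, ENNReal.toReal_mul, ENNReal.toReal_ofReal (weight_nonneg hk (h4.2.1 0)),
      mzv_eq_toReal]
  · intro s hs
    rw [h3 s hs]
    exact ENNReal.mul_ne_top ENNReal.ofReal_ne_top (hfin s hs)

/-- A sum over admissible pairs as a sum over the first entry. -/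
theorem sum_admissible_two (n : ℕ) (F : (Fin 2 → ℕ) → ℝ) :
    ∑ s ∈ admissible 2 n, F s = ∑ i ∈ Icc 2 (n - 1), F ![i, n - i] := by
  refine sum_bij' (fun s _ => s 0) (fun i _ => ![i, n - i]) ?_ ?_ ?_ ?_ ?_
  · intro s hs
    have h := mem_admissible_succ.1 hs
    rw [Fin.sum_univ_two] at h
    have := h.2.1 1
    rw [mem_Icc]
    omega
  · intro i hi
    rw [mem_Icc] at hi
    rw [mem_admissible_succ, Fin.sum_univ_two, Fin.forall_fin_two]
    simp
    omega
  · intro s hs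
    have h := mem_admissible_succ.1 hs
    rw [Fin.sum_univ_two] at h
    funext i
    fin_cases i
    · rfl
    · simp
      omega
  · intro i _
    rfl
  · intro s hs
    have h := mem_admissible_succ.1 hs
    rw [Fin.sum_univ_two] at h
    congr 1
    funext i
    fin_cases i
    · rfl
    · simp
      omega

theorem weight_two (i l : ℕ) (hi : 1 ≤ i) : weight le_rfl ![i, l] = 2 ^ i - 1 := by
  rw [weight_eq (r := 0), coeffC_zero, Matrix.cons_val_zero, two_zpow_sub_one hi]
  obtain ⟨a, rfl⟩ := Nat.exists_eq_add_of_le' hi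
  rw [Nat.add_sub_cancel, pow_succ]
  ring

end MZV

theorem mainTheorem1 :
    (∀ (k n : ℕ) (hk : 2 ≤ k), k + 1 ≤ n →
      (∀ s ∈ MZV.admissible k n, Summable (MZV.term s)) ∧
      ((∑ s ∈ MZV.admissible k n, MZV.weight hk s * MZV.mzv s : ℝ) : ℂ)
        = (n : ℂ) * riemannZeta n ∧
      (∀ s ∈ MZV.admissible k n, MZV.weight hk s = MZV.weightC hk s) ∧
      ((∑ t ∈ MZV.admissible k n, MZV.weightC hk t * MZV.mzv t : ℝ) : ℂ)
        = (n : ℂ) * riemannZeta n) ∧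
    (∀ n : ℕ, 3 ≤ n →
      ((∑ i ∈ Finset.Icc 2 (n - 1), ((2 : ℝ) ^ i - 1) * MZV.mzv ![i, n - i] : ℝ) : ℂ)
        = (n : ℂ) * riemannZeta n ∧
      ((∑ i ∈ Finset.Icc 2 (n - 1), (2 : ℝ) ^ i * MZV.mzv ![i, n - i] : ℝ) : ℂ)
        = ((n : ℂ) + 1) * riemannZeta n) := by
  constructor
  · intro k n hk hn
    obtain ⟨r, rfl⟩ := Nat.exists_eq_add_of_le' hk
    have h1 : ∀ s, MZV.weight hk s = MZV.weightC hk s := fun s => by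
      rw [MZV.weight_eq, MZV.weightC_eq]
    have h2 : ((∑ s ∈ MZV.admissible (r + 2) n, MZV.weight hk s * MZV.mzv s : ℝ) : ℂ)
        = (n : ℂ) * riemannZeta n := by
      rw [MZV.sum_admissible_weight_mul_mzv hk hn, ← MZV.ofReal_toReal_ezeta (by omega)]
      push_cast
      rfl
    refine ⟨fun s hs => MZV.summable_term (MZV.emzv_ne_top hn hs), h2, fun s _ => h1 s, ?_⟩
    simp_rw [← h1]
    exact h2
  · intro n hn
    have h1 : ∑ i ∈ Finset.Icc 2 (n - 1), ((2 : ℝ) ^ i - 1) * MZV.mzv ![i, n - i]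
        = n * (MZV.ezeta n).toReal := by
      rw [← MZV.sum_admissible_weight_mul_mzv (r := 0) le_rfl hn, MZV.sum_admissible_two]
      refine Finset.sum_congr rfl fun i hi => ?_
      rw [MZV.weight_two i _ (by have := (Finset.mem_Icc.1 hi).1; omega)]
    -- The unweighted sum formula in depth 2 accounts for the difference between `2^i - 1` and
    -- `2^i`.
    have h2 : ∑ i ∈ Finset.Icc 2 (n - 1), MZV.mzv ![i, n - i] = (MZV.ezeta n).toReal := by
      rw [← MZV.sum_admissible_mzv (k := 1) hn, MZV.sum_admissible_two]
    have h3 : ∑ i ∈ Finset.Icc 2 (n - 1), (2 : ℝ) ^ i * MZV.mzv ![i, n - i]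
        = (n + 1) * (MZV.ezeta n).toReal := by
      rw [add_mul, one_mul, ← h1, ← h2, ← Finset.sum_add_distrib]
      exact Finset.sum_congr rfl fun i _ => by ring
    rw [h1, h3, ← MZV.ofReal_toReal_ezeta (by omega)]
    push_cast
    exact ⟨rfl, rfl⟩
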